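/- Let $k$ be a field of characteristic $0$. Let $\mathrm{DerNov}$ be the binary quadratic operad over $k$ of the variety of algebras with two bilinear operations $\prec,\succ$ and the identities $$(a\prec b)\prec c=(a\prec c)\prec b,$$ $$a\succ(b\succ c)+(b\succ c)\prec a=b\succ(a\succ c)+(a\succ c)\prec b,$$ $$(a\succ b)\succ c-(a\succ c)\prec b=(a\succ c)\succ b-(a\succ b)\prec c,$$ $$(a\prec b)\succ c-a\prec(c\prec b)+(a\prec c)\prec b+c\succ(a\prec b)=(c\prec b)\succ a-c\prec(a\prec b)+(c\prec a)\prec b+a\succ(c\prec b).$$ Let $\mathrm{DerNov}^!$ be its Koszul (quadratic) dual operad: it is again generated by two binary operations, and its space of relations in arity $3$ is the orthogonal complement of the relations of $\mathrm{DerNov}$ with respect to the pairing in which distinct multilinear nonassociative monomials in $x_1,x_2,x_3$ are orthogonal, each monomial $(x_{\sigma(1)}\ast x_{\sigma(2)})\ast' x_{\sigma(3)}$ has square $\operatorname{sgn}\sigma$, and each monomial $x_{\sigma(1)}\ast(x_{\sigma(2)}\ast' x_{\sigma(3)})$ has square $-\operatorname{sgn}\sigma$, for $\sigma\in S_3$ and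 $\ast,\ast'\in\{\prec,\succ\}$. Two formal distributions $a(z),b(z)\in A[[z,z^{-1}]]$ over an algebra $A$ are called mutually local if there is $N\ge 0$ such that $(w-z)^N\,a(w)\ast b(z)=0=(w-z)^N\,b(z)\ast a(w)$ for every operation $\ast$ of $A$. A binary quadratic operad $P$ satisfies the Dong property if for every $P$-algebra $A$, all pairwise mutually local $a(z),b(z),c(z)\in A[[z,z^{-1}]]$, every generating operation $\ast$ of $P$ or its opposite, and every $n\ge 0$, the formal distribution $$(a_{(n)}b)(z)=\operatorname{Res}_{w=0}\,(w-z)^n\,a(w)\ast b(z)$$ is mutually local with $c(z)$. Then the operad $\mathrm{DerNov}^!$ satisfies the Dong property. -/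

import Mathlib

universe u v w

/-! ### Binary quadratic operads (all generating operations without symmetry) -/

/-- The multilinear nonassociative monomials of degree three in `x₀, x₁, x₂` built from binary
operations indexed by `ι`; they form a basis of the arity three component of the free operad on
`ι` binary operations without symmetry.

* `left i j σ` is the monomial `(x_{σ 0} i x_{σ 1}) j x_{σ 2}`;
* `right i j σ` is the monomial `x_{σ 0} i (x_{σ 1} j x_{σ 2})`. -/
inductive QuadMonomial (ι : Type w) : Type w
  | left (i j : ι) (σ : Equiv.Perm (Fin 3)) : QuadMonomial ι
  | right (i j : ι) (σ : Equiv.Perm (Fin 3)) : QuadMonomial ι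

namespace QuadMonomial

variable {ι : Type w}

/-- Renaming of the variables, `x_i ↦ x_{τ i}`: the action of the symmetric group `S₃`. -/
def relabel (τ : Equiv.Perm (Fin 3)) : QuadMonomial ι → QuadMonomial ι
  | left i j σ => left i j (τ * σ)
  | right i j σ => right i j (τ * σ)

/-- The sign in the pairing that defines quadratic duality: `sgn σ` on the monomials
`(x_{σ 0} i x_{σ 1}) j x_{σ 2}` and `- sgn σ` on the monomials `x_{σ 0} i (x_{σ 1} j x_{σ 2})`. -/
def sgn : QuadMonomial ι → ℤˣ
  | left _ _ σ => Equiv.Perm.sign σ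
  | right _ _ σ => - Equiv.Perm.sign σ

/-- The value of a monomial at `x₀, x₁, x₂` in a vector space `A` with bilinear operations
`μ i`. -/
def eval {k : Type u} [Field k] {A : Type v} [AddCommGroup A] [Module k A]
    (μ : ι → A →ₗ[k] A →ₗ[k] A) (x : Fin 3 → A) : QuadMonomial ι → A
  | left i j σ => μ j (μ i (x (σ 0)) (x (σ 1))) (x (σ 2))
  | right i j σ => μ i (x (σ 0)) (μ j (x (σ 1)) (x (σ 2)))

theorem sgn_relabel (τ : Equiv.Perm (Fin 3)) (m : QuadMonomial ι) :
    (m.relabel τ).sgn = Equiv.Perm.sign τ * m.sgn := by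
  cases m <;> simp [relabel, sgn]

theorem relabel_mul (τ τ' : Equiv.Perm (Fin 3)) (m : QuadMonomial ι) :
    m.relabel (τ * τ') = (m.relabel τ').relabel τ := by
  cases m <;> simp [relabel, mul_assoc]

theorem relabel_injective (τ : Equiv.Perm (Fin 3)) :
    Function.Injective (relabel τ : QuadMonomial ι → QuadMonomial ι) := by
  intro m m' h
  cases m <;> cases m' <;> simp_all [relabel]

end QuadMonomial

/-- A binary quadratic operad over `k`, given by its quadratic presentation: it is generated by
binary operations without symmetry indexed by `ι`, and its relations form an `S₃`-submodule of the
arity three component of the free operad on these operations. -/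
structure BinaryQuadraticOperad (k : Type u) [Field k] (ι : Type w) where
  /-- the quadratic relations -/
  rel : Submodule k (QuadMonomial ι →₀ k)
  /-- the relations are stable under the symmetric group -/
  relabel_mem : ∀ (τ : Equiv.Perm (Fin 3)), ∀ f ∈ rel,
    Finsupp.mapDomain (QuadMonomial.relabel τ) f ∈ rel

namespace BinaryQuadraticOperad

variable {k : Type u} [Field k] {ι : Type w}

/-- The operad of the variety defined by a set of multilinear identities `f = 0`, `f ∈ S`, of
degree three: the relations are spanned by the elements of `S` with all renamings of variables. -/
noncomputable def ofIdentities (S : Set (QuadMonomial ι →₀ k)) : BinaryQuadraticOperad k ι where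
  rel := Submodule.span k
    {g | ∃ τ : Equiv.Perm (Fin 3), ∃ f ∈ S, g = Finsupp.mapDomain (QuadMonomial.relabel τ) f}
  relabel_mem := by
    intro τ f hf
    have hle : Submodule.span k {g : QuadMonomial ι →₀ k | ∃ τ : Equiv.Perm (Fin 3), ∃ f ∈ S,
          g = Finsupp.mapDomain (QuadMonomial.relabel τ) f} ≤
        (Submodule.span k {g : QuadMonomial ι →₀ k | ∃ τ : Equiv.Perm (Fin 3), ∃ f ∈ S,
          g = Finsupp.mapDomain (QuadMonomial.relabel τ) f}).comap
          (Finsupp.lmapDomain k k (QuadMonomial.relabel τ)) := by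
      rw [Submodule.span_le]
      rintro g ⟨τ', f, hf, rfl⟩
      refine Submodule.subset_span ⟨τ * τ', f, hf, ?_⟩
      rw [Finsupp.lmapDomain_apply, ← Finsupp.mapDomain_comp]
      congr 1
      funext m
      exact (QuadMonomial.relabel_mul τ τ' m).symm
    exact hle hf

/-- The pairing on the span of the monomials of degree three for which distinct monomials are
orthogonal and each monomial `m` satisfies `⟨m, m⟩ = m.sgn`. -/
noncomputable def pairing (f g : QuadMonomial ι →₀ k) : k :=
  f.sum fun m c => c * ((m.sgn : ℤ) : k) * g m

/-- The quadratic (Koszul) dual operad `P^!`: its generating operations are dual to those of `P`,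
and its relations are the orthogonal complement of the relations of `P`. -/
noncomputable def dual [Finite ι] (P : BinaryQuadraticOperad k ι) : BinaryQuadraticOperad k ι where
  rel :=
    { carrier := {f | ∀ g ∈ P.rel, pairing f g = 0}
      zero_mem' := by
        intro g _
        simp [pairing]
      add_mem' := by
        intro f f' hf hf' g hg
        have h := hf g hg
        have h' := hf' g hg
        unfold pairing at h h' ⊢
        rw [Finsupp.sum_add_index' (by simp) (by intros; ring), h, h', add_zero]
      smul_mem' := by
        intro c f hf g hg
        have h := hf g hg
        unfold pairing at h ⊢
        rw [Finsupp.sum_smul_index' (by simp)]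
        simp only [smul_eq_mul, mul_assoc]
        simp only [mul_assoc] at h
        rw [← Finsupp.mul_sum, h, mul_zero] }
  relabel_mem := by
    intro τ f hf g hg
    have h := hf _ (P.relabel_mem τ⁻¹ g hg)
    have key : ∀ m : QuadMonomial ι,
        Finsupp.mapDomain (QuadMonomial.relabel τ⁻¹) g m = g (m.relabel τ) := by
      intro m
      have hm : m = (m.relabel τ).relabel τ⁻¹ := by
        cases m <;> simp [QuadMonomial.relabel]
      conv_lhs => rw [hm]
      exact Finsupp.mapDomain_apply (QuadMonomial.relabel_injective _) _ _
    unfold pairing at h ⊢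
    rw [Finsupp.sum_mapDomain_index (by simp) (by intros; ring)]
    have hs : (f.sum fun m c => c * (((m.relabel τ).sgn : ℤ) : k) * g (m.relabel τ)) =
        ((Equiv.Perm.sign τ : ℤ) : k) * f.sum fun m c => c * ((m.sgn : ℤ) : k) *
          Finsupp.mapDomain (QuadMonomial.relabel τ⁻¹) g m := by
      rw [Finsupp.mul_sum]
      refine Finsupp.sum_congr fun m _ => ?_
      rw [key, QuadMonomial.sgn_relabel]
      push_cast
      ring
    rw [hs, h, mul_zero]

/-- A vector space `A` with bilinear operations `μ i` is an algebra over the operad `P`: all the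
relations of `P` hold identically in `A`. -/
def IsAlgebra (P : BinaryQuadraticOperad k ι) {A : Type v} [AddCommGroup A] [Module k A]
    (μ : ι → A →ₗ[k] A →ₗ[k] A) : Prop :=
  ∀ f ∈ P.rel, ∀ x : Fin 3 → A, (f.sum fun m c => c • m.eval μ x) = 0

end BinaryQuadraticOperad

/-! ### Formal distributions, locality, and the Dong property -/

/-- A formal distribution `a(z) = ∑_{n ∈ ℤ} a n z^{-n-1}` in `A[[z, z⁻¹]]`. -/
abbrev FormalDistribution (A : Type v) : Type v := ℤ → A

/-- A formal distribution in two variables,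
`F(w, z) = ∑_{m, n ∈ ℤ} F m n w^{-m-1} z^{-n-1}` in `A[[w, w⁻¹, z, z⁻¹]]`. -/
abbrev FormalDistribution₂ (A : Type v) : Type v := ℤ → ℤ → A

namespace FormalDistribution

/-- Multiplication by `w - z`: `F(w, z) ↦ (w - z) F(w, z)`. -/
def mulSub {A : Type v} [AddCommGroup A] (F : FormalDistribution₂ A) : FormalDistribution₂ A :=
  fun m n => F (m + 1) n - F m (n + 1)

variable {k : Type u} [Field k] {ι : Type w} {A : Type v} [AddCommGroup A] [Module k A]

/-- `(w - z)^N a(w) b(z)`, where the product is taken with respect to the bilinear operation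
`β`. For `β` replaced by `β.flip` this is `(w - z)^N b(z) a(w)`. -/
def localProd (β : A →ₗ[k] A →ₗ[k] A) (N : ℕ) (a b : FormalDistribution A) :
    FormalDistribution₂ A :=
  mulSub^[N] fun m n => β (a m) (b n)

/-- The `n`-th product `(a _(n) b)(z) = Res_{w = 0} (w - z)^n a(w) b(z)`, `n ≥ 0`, with respect to
the bilinear operation `β`; `Res_{w = 0}` is the coefficient at `w⁻¹`. -/
def nthProd (β : A →ₗ[k] A →ₗ[k] A) (n : ℕ) (a b : FormalDistribution A) :
    FormalDistribution A :=
  localProd β n a b 0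

/-- `a(z)` and `b(z)` are mutually local in the algebra `A` with bilinear operations `μ i`: for
some `N ≥ 0` and every operation, `(w - z)^N a(w) b(z) = 0 = (w - z)^N b(z) a(w)`. -/
def MutuallyLocal (μ : ι → A →ₗ[k] A →ₗ[k] A) (a b : FormalDistribution A) : Prop :=
  ∃ N : ℕ, ∀ i, localProd (μ i) N a b = 0 ∧ localProd (μ i).flip N a b = 0

end FormalDistribution

open FormalDistribution in
/-- The Dong property of a binary quadratic operad `P`: for every `P`-algebra `A` and all pairwise
mutually local formal distributions `a, b, c` over `A`, each `n`-th product of `a` and `b`, `n ≥ 0`,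
with respect to any generating operation of `P` or its opposite, is mutually local with `c`. -/
def BinaryQuadraticOperad.HasDongProperty {k : Type u} [Field k] {ι : Type w}
    (P : BinaryQuadraticOperad k ι) : Prop :=
  ∀ (A : Type v) [AddCommGroup A] [Module k A] (μ : ι → A →ₗ[k] A →ₗ[k] A), P.IsAlgebra μ →
    ∀ a b c : FormalDistribution A,
      MutuallyLocal μ a b → MutuallyLocal μ b c → MutuallyLocal μ a c →
      ∀ (i : ι) (n : ℕ),
        MutuallyLocal μ (nthProd (μ i) n a b) c ∧ MutuallyLocal μ (nthProd (μ i).flip n a b) c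

/-! ### The operad `DerNov` -/

namespace DerNov

/-- The two binary operations `≺` and `≻`. -/
inductive Op : Type
  | prec : Op
  | succ : Op

instance : Finite Op :=
  Finite.of_surjective (fun b : Bool => if b then Op.prec else Op.succ) (by
    rintro (_ | _)
    · exact ⟨true, rfl⟩
    · exact ⟨false, rfl⟩)

/-! The six orders of the variables `a = x₀`, `b = x₁`, `c = x₂`. -/

/-- The order `a, b, c`. -/
def abc : Equiv.Perm (Fin 3) := ⟨![0, 1, 2], ![0, 1, 2], by decide, by decide⟩
/-- The order `a, c, b`. -/
def acb : Equiv.Perm (Fin 3) := ⟨![0, 2, 1], ![0, 2, 1], by decide, by decide⟩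
/-- The order `b, a, c`. -/
def bac : Equiv.Perm (Fin 3) := ⟨![1, 0, 2], ![1, 0, 2], by decide, by decide⟩
/-- The order `b, c, a`. -/
def bca : Equiv.Perm (Fin 3) := ⟨![1, 2, 0], ![2, 0, 1], by decide, by decide⟩
/-- The order `c, a, b`. -/
def cab : Equiv.Perm (Fin 3) := ⟨![2, 0, 1], ![1, 2, 0], by decide, by decide⟩
/-- The order `c, b, a`. -/
def cba : Equiv.Perm (Fin 3) := ⟨![2, 1, 0], ![2, 1, 0], by decide, by decide⟩

variable (k : Type u) [Field k]

/-- `lm k i j xyz` is `(x i y) j z`. -/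
noncomputable def lm (i j : Op) (σ : Equiv.Perm (Fin 3)) : QuadMonomial Op →₀ k :=
  Finsupp.single (QuadMonomial.left i j σ) 1

/-- `rm k i j xyz` is `x i (y j z)`. -/
noncomputable def rm (i j : Op) (σ : Equiv.Perm (Fin 3)) : QuadMonomial Op →₀ k :=
  Finsupp.single (QuadMonomial.right i j σ) 1

open Op

/-- `(a ≺ b) ≺ c = (a ≺ c) ≺ b`. -/
noncomputable def identity₁ : QuadMonomial Op →₀ k :=
  lm k prec prec abc - lm k prec prec acb

/-- `a ≻ (b ≻ c) + (b ≻ c) ≺ a = b ≻ (a ≻ c) + (a ≻ c) ≺ b`. -/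
noncomputable def identity₂ : QuadMonomial Op →₀ k :=
  (rm k succ succ abc + lm k succ prec bca) - (rm k succ succ bac + lm k succ prec acb)

/-- `(a ≻ b) ≻ c - (a ≻ c) ≺ b = (a ≻ c) ≻ b - (a ≻ b) ≺ c`. -/
noncomputable def identity₃ : QuadMonomial Op →₀ k :=
  (lm k succ succ abc - lm k succ prec acb) - (lm k succ succ acb - lm k succ prec abc)

/-- `(a ≺ b) ≻ c - a ≺ (c ≺ b) + (a ≺ c) ≺ b + c ≻ (a ≺ b) =
(c ≺ b) ≻ a - c ≺ (a ≺ b) + (c ≺ a) ≺ b + a ≻ (c ≺ b)`. -/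
noncomputable def identity₄ : QuadMonomial Op →₀ k :=
  (lm k prec succ abc - rm k prec prec acb + lm k prec prec acb + rm k succ prec cab) -
    (lm k prec succ cba - rm k prec prec cab + lm k prec prec cab + rm k succ prec acb)

end DerNov

/-- The operad `DerNov` of the variety of algebras with two operations `≺` and `≻` that is defined
by the four identities above. -/
noncomputable def derNov (k : Type u) [Field k] : BinaryQuadraticOperad k DerNov.Op :=
  BinaryQuadraticOperad.ofIdentities
    {DerNov.identity₁ k, DerNov.identity₂ k, DerNov.identity₃ k, DerNov.identity₄ k}

-- As for the classical Dong lemma, the question lives in three variables. If a product of degree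
-- three of `a`, `b`, `c` is killed by a power of `z₁ - z₂`, it stays so after multiplication by
-- `(z₀ - z₁)^n`, and taking the residue in `z₀` gives the required locality
-- (`hasDongProperty_of_localAt`). The hypothesis only gives locality of a monomial in the pair of
-- its inner product. Since `z_p - z_r = (z_p - z_q) + (z_q - z_r)`, locality in two pairs implies
-- locality in the third, so one further pair suffices. It comes from the identities of the dual
-- operad: `(x ≻ y) ≻ z`, `(x ≺ y) ≻ z` and `x ≻ (y ≻ z)` each have a symmetry moving the outer
-- variable into the inner product; `(x ≺ y) ≺ z` has one modulo monomials of the second type; the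
-- other four types vanish or are combinations of the first three. Only these eight identities are
-- needed, not a full description of the dual.

namespace BinaryQuadraticOperad

-- Testing membership in the quadratic dual

theorem pairing_eq_linearCombination {k : Type u} [Field k] {ι : Type w}
    (f g : QuadMonomial ι →₀ k) :
    pairing f g = Finsupp.linearCombination k (fun m => ((m.sgn : ℤ) : k) * g m) f := by
  simp [pairing, Finsupp.linearCombination_apply, mul_assoc]

theorem pairing_comm {k : Type u} [Field k] {ι : Type w} (f g : QuadMonomial ι →₀ k) :
    pairing f g = pairing g f := by
  classical
  have h : ∀ f g : QuadMonomial ι →₀ k,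
      pairing f g = ∑ m ∈ f.support ∪ g.support, f m * ((m.sgn : ℤ) : k) * g m := fun f g =>
    Finsupp.sum_of_support_subset f Finset.subset_union_left _ (by simp)
  rw [h, h, Finset.union_comm]
  exact Finset.sum_congr rfl fun m _ => by ring

/-- The relations of the dual of the operad of a variety are the elements orthogonal to all
renamings of the defining identities. -/
theorem mem_rel_dual_ofIdentities {k : Type u} [Field k] {ι : Type w} [Finite ι]
    {S : Set (QuadMonomial ι →₀ k)} {f : QuadMonomial ι →₀ k}
    (h : ∀ g ∈ S, ∀ τ, pairing (Finsupp.mapDomain (QuadMonomial.relabel τ) g) f = 0) :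
    f ∈ (ofIdentities S).dual.rel := by
  intro g hg
  -- With `f` fixed the pairing is linear in `g`, so its vanishing is membership in a kernel and can
  -- be tested on the spanning set.
  rw [pairing_comm, pairing_eq_linearCombination]
  revert g
  change Submodule.span k _ ≤
    LinearMap.ker (Finsupp.linearCombination k fun m => ((m.sgn : ℤ) : k) * f m)
  rw [Submodule.span_le]
  rintro _ ⟨τ, g, hg, rfl⟩
  rw [SetLike.mem_coe, LinearMap.mem_ker, ← pairing_eq_linearCombination]
  exact h g hg τ

end BinaryQuadraticOperad

-- Identities of the dual of `DerNov`

namespace DerNov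

open Op

theorem perm_cases (τ : Equiv.Perm (Fin 3)) :
    τ = abc ∨ τ = acb ∨ τ = bac ∨ τ = bca ∨ τ = cab ∨ τ = cba := by
  revert τ; decide

/-- Since `sgn (τ * σ) = sgn τ * sgn σ`, the factor `sgn τ` splits off each pairing; the equations
are what remains of the four identities once the signs of the pairing are absorbed. -/
theorem mem_rel_dual {k : Type u} [Field k] {f : QuadMonomial Op →₀ k}
    (h : ∀ τ : Equiv.Perm (Fin 3),
      (f (.left prec prec (τ * abc)) + f (.left prec prec (τ * acb)) = 0) ∧
      (- f (.right succ succ (τ * abc)) + f (.left succ prec (τ * bca))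
        - f (.right succ succ (τ * bac)) + f (.left succ prec (τ * acb)) = 0) ∧
      (f (.left succ succ (τ * abc)) + f (.left succ prec (τ * acb))
        + f (.left succ succ (τ * acb)) + f (.left succ prec (τ * abc)) = 0) ∧
      (f (.left prec succ (τ * abc)) - f (.right prec prec (τ * acb))
        - f (.left prec prec (τ * acb)) - f (.right succ prec (τ * cab))
        + f (.left prec succ (τ * cba)) - f (.right prec prec (τ * cab))
        - f (.left prec prec (τ * cab)) - f (.right succ prec (τ * acb)) = 0)) :
    f ∈ (derNov k).dual.rel := by
  refine BinaryQuadraticOperad.mem_rel_dual_ofIdentities fun g hg τ => ?_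
  have hs : ∀ σ, Equiv.Perm.sign (τ * σ) = Equiv.Perm.sign τ * Equiv.Perm.sign σ :=
    Equiv.Perm.sign_mul τ
  have h₁ : Equiv.Perm.sign abc = 1 := by decide
  have h₂ : Equiv.Perm.sign acb = -1 := by decide
  have h₃ : Equiv.Perm.sign bac = -1 := by decide
  have h₄ : Equiv.Perm.sign bca = 1 := by decide
  have h₅ : Equiv.Perm.sign cab = 1 := by decide
  have h₆ : Equiv.Perm.sign cba = -1 := by decide
  obtain ⟨e₁, e₂, e₃, e₄⟩ := h τ
  rw [BinaryQuadraticOperad.pairing_eq_linearCombination, ← Finsupp.lmapDomain_apply k k]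
  rcases hg with rfl | rfl | rfl | rfl
  · simp only [identity₁, lm, map_sub, Finsupp.lmapDomain_apply, Finsupp.mapDomain_single,
      Finsupp.linearCombination_single, QuadMonomial.relabel, QuadMonomial.sgn, hs, h₁, h₂]
    push_cast
    linear_combination ((Equiv.Perm.sign τ : ℤ) : k) * e₁
  · simp only [identity₂, lm, rm, map_sub, map_add, Finsupp.lmapDomain_apply,
      Finsupp.mapDomain_single, Finsupp.linearCombination_single, QuadMonomial.relabel,
      QuadMonomial.sgn, hs, h₁, h₂, h₃, h₄]
    push_cast
    linear_combination ((Equiv.Perm.sign τ : ℤ) : k) * e₂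
  · simp only [identity₃, lm, map_sub, Finsupp.lmapDomain_apply, Finsupp.mapDomain_single,
      Finsupp.linearCombination_single, QuadMonomial.relabel, QuadMonomial.sgn, hs, h₁, h₂]
    push_cast
    linear_combination ((Equiv.Perm.sign τ : ℤ) : k) * e₃
  · simp only [identity₄, lm, rm, map_sub, map_add, Finsupp.lmapDomain_apply,
      Finsupp.mapDomain_single, Finsupp.linearCombination_single, QuadMonomial.relabel,
      QuadMonomial.sgn, hs, h₁, h₂, h₅, h₆]
    push_cast
    linear_combination ((Equiv.Perm.sign τ : ℤ) : k) * e₄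

section DualIdentities

variable {k : Type u} [Field k] {A : Type v} [AddCommGroup A] [Module k A]
  {μ : Op → A →ₗ[k] A →ₗ[k] A}

theorem linearCombination_eval_eq_zero (hμ : (derNov k).dual.IsAlgebra μ)
    {f : QuadMonomial Op →₀ k} (hf : f ∈ (derNov k).dual.rel) (x y z : A) :
    Finsupp.linearCombination k (fun m : QuadMonomial Op => m.eval μ ![x, y, z]) f = 0 :=
  hμ f hf ![x, y, z]

theorem succ_succ_right_comm (hμ : (derNov k).dual.IsAlgebra μ) (x y z : A) :
    μ succ (μ succ x y) z = μ succ (μ succ x z) y := by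
  classical
  have h := linearCombination_eval_eq_zero hμ
    (f := lm k succ succ abc - lm k succ succ acb)
    (mem_rel_dual fun τ => by
      -- For a concrete `τ` every coefficient reduces to a decidable equality of permutations.
      rcases perm_cases τ with rfl | rfl | rfl | rfl | rfl | rfl <;>
      simp +decide [lm, Finsupp.single_apply]) x y z
  simpa [lm, QuadMonomial.eval, abc, acb, sub_eq_zero] using h

theorem prec_succ_swap (hμ : (derNov k).dual.IsAlgebra μ) (x y z : A) :
    μ succ (μ prec x y) z = μ succ (μ prec z y) x := by
  classical
  have h := linearCombination_eval_eq_zero hμ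
    (f := lm k prec succ abc - lm k prec succ cba)
    (mem_rel_dual fun τ => by
      rcases perm_cases τ with rfl | rfl | rfl | rfl | rfl | rfl <;>
      simp +decide [lm, Finsupp.single_apply]) x y z
  simpa [lm, QuadMonomial.eval, abc, cba, sub_eq_zero] using h

theorem succ_succ_left_comm (hμ : (derNov k).dual.IsAlgebra μ) (x y z : A) :
    μ succ x (μ succ y z) = μ succ y (μ succ x z) := by
  classical
  have h := linearCombination_eval_eq_zero hμ
    (f := rm k succ succ abc - rm k succ succ bac)
    (mem_rel_dual fun τ => by
      rcases perm_cases τ with rfl | rfl | rfl | rfl | rfl | rfl <;>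
      simp +decide [rm, Finsupp.single_apply]) x y z
  simpa [rm, QuadMonomial.eval, abc, bac, sub_eq_zero] using h

theorem succ_prec_eq (hμ : (derNov k).dual.IsAlgebra μ) (x y z : A) :
    μ prec (μ succ x y) z - (μ succ (μ succ x y) z - μ succ x (μ succ z y)) = 0 := by
  classical
  have h := linearCombination_eval_eq_zero hμ
    (f := lm k succ prec abc - (lm k succ succ abc - rm k succ succ acb))
    (mem_rel_dual fun τ => by
      rcases perm_cases τ with rfl | rfl | rfl | rfl | rfl | rfl <;>
      simp +decide [lm, rm, Finsupp.single_apply]) x y z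
  simpa [lm, rm, QuadMonomial.eval, abc, acb] using h

theorem succ_prec_right_eq (hμ : (derNov k).dual.IsAlgebra μ) (x y z : A) :
    μ succ x (μ prec y z) + μ succ (μ prec x z) y = 0 := by
  classical
  have h := linearCombination_eval_eq_zero hμ
    (f := rm k succ prec abc + lm k prec succ acb)
    (mem_rel_dual fun τ => by
      rcases perm_cases τ with rfl | rfl | rfl | rfl | rfl | rfl <;>
      simp +decide [lm, rm, Finsupp.single_apply]) x y z
  simpa [lm, rm, QuadMonomial.eval, abc, acb] using h

theorem prec_prec_right_eq (hμ : (derNov k).dual.IsAlgebra μ) (x y z : A) :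
    μ prec x (μ prec y z) + μ succ (μ prec x z) y = 0 := by
  classical
  have h := linearCombination_eval_eq_zero hμ
    (f := rm k prec prec abc + lm k prec succ acb)
    (mem_rel_dual fun τ => by
      rcases perm_cases τ with rfl | rfl | rfl | rfl | rfl | rfl <;>
      simp +decide [lm, rm, Finsupp.single_apply]) x y z
  simpa [lm, rm, QuadMonomial.eval, abc, acb] using h

theorem prec_succ_right_eq_zero (hμ : (derNov k).dual.IsAlgebra μ) (x y z : A) :
    μ prec x (μ succ y z) = 0 := by
  classical
  have h := linearCombination_eval_eq_zero hμ
    (f := rm k prec succ abc)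
    (mem_rel_dual fun τ => by
      rcases perm_cases τ with rfl | rfl | rfl | rfl | rfl | rfl <;>
      simp +decide [rm]) x y z
  simpa [rm, QuadMonomial.eval, abc] using h

/-- The difference `(x ≺ y) ≺ z - (x ≺ z) ≺ y` alone is not orthogonal to `identity₄`; the `(≺) ≻`
terms compensate. -/
theorem prec_prec_add_symm (hμ : (derNov k).dual.IsAlgebra μ) (x y z : A) :
    μ prec (μ prec x y) z + μ succ (μ prec x z) y =
      μ prec (μ prec x z) y + μ succ (μ prec x y) z := by
  classical
  have h := linearCombination_eval_eq_zero hμ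
    (f := lm k prec prec abc + lm k prec succ acb - (lm k prec prec acb + lm k prec succ abc))
    (mem_rel_dual fun τ => by
      rcases perm_cases τ with rfl | rfl | rfl | rfl | rfl | rfl <;>
      simp +decide [lm, Finsupp.single_apply]) x y z
  simpa [lm, QuadMonomial.eval, abc, acb, sub_eq_zero] using h

end DualIdentities

end DerNov

/-! ### Distributions in three variables -/

namespace FormalDistribution

open Module

theorem mulSub_iterate_eq_zero_of_le {A : Type v} [AddCommGroup A] {F : FormalDistribution₂ A}
    {M N : ℕ} (h : mulSub^[M] F = 0) (hMN : M ≤ N) : mulSub^[N] F = 0 := by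
  obtain ⟨d, rfl⟩ := Nat.exists_eq_add_of_le' hMN
  rw [Function.iterate_add_apply, h]
  exact Function.iterate_fixed (by funext m n; simp [mulSub]) d

theorem mulSub_iterate_swap {A : Type v} [AddCommGroup A] (F : FormalDistribution₂ A) (N : ℕ)
    (m n : ℤ) : (mulSub^[N] fun m n => F n m) m n = (-1) ^ N • (mulSub^[N] F) n m := by
  induction N generalizing m n with
  | zero => simp
  | succ N ih =>
    rw [Function.iterate_succ_apply', Function.iterate_succ_apply']
    simp only [mulSub, ih, pow_succ, smul_sub, mul_neg, mul_one, neg_smul]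
    abel

variable (k : Type u) [Field k] (A : Type v) [AddCommGroup A] [Module k A]

/-- Multiplication by the `p`-th variable on formal distributions in three variables. -/
def mulVar (p : Fin 3) : End k ((Fin 3 → ℤ) → A) :=
  LinearMap.funLeft k A fun v => v + Pi.single p 1

/-- Multiplication by the difference of the `p`-th and the `q`-th variables on formal
distributions in three variables. -/
def mulDiff (p q : Fin 3) : End k ((Fin 3 → ℤ) → A) :=
  mulVar k A p - mulVar k A q

theorem commute_mulVar (p q : Fin 3) : Commute (mulVar k A p) (mulVar k A q) := by
  refine LinearMap.ext fun F => funext fun v => ?_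
  simp [mulVar, LinearMap.funLeft_apply, add_right_comm]

theorem commute_mulDiff (p q r s : Fin 3) : Commute (mulDiff k A p q) (mulDiff k A r s) :=
  .sub_left (.sub_right (commute_mulVar k A _ _) (commute_mulVar k A _ _))
    (.sub_right (commute_mulVar k A _ _) (commute_mulVar k A _ _))

/-- The formal distributions in three variables that are annihilated by some power of the
difference of the `p`-th and the `q`-th variables. -/
def localAt (p q : Fin 3) : Submodule k ((Fin 3 → ℤ) → A) :=
  (mulDiff k A p q).maxGenEigenspace 0

variable {k A}

theorem mem_localAt {p q : Fin 3} {F : (Fin 3 → ℤ) → A} :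
    F ∈ localAt k A p q ↔ ∃ N : ℕ, (mulDiff k A p q ^ N) F = 0 := by
  simp [localAt, End.mem_maxGenEigenspace]

theorem localAt_comm (p q : Fin 3) : localAt k A p q = localAt k A q p := by
  ext F
  have h : mulDiff k A p q = (-1 : k) • mulDiff k A q p :=
    LinearMap.ext fun F => funext fun v => by simp [mulDiff]
  simp [mem_localAt, h, smul_pow]

theorem mem_localAt_symm {p q : Fin 3} {F : (Fin 3 → ℤ) → A} (h : F ∈ localAt k A p q) :
    F ∈ localAt k A q p :=
  (localAt_comm p q).le h

/-- The two differences commute and add up to the third, so the binomial theorem applies; here it is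
the statement on sums of commuting endomorphisms for generalized eigenspaces at `0 + 0`. -/
theorem mem_localAt_of_mem_of_mem {p q r : Fin 3} {F : (Fin 3 → ℤ) → A}
    (h₁ : F ∈ localAt k A p q) (h₂ : F ∈ localAt k A q r) : F ∈ localAt k A p r := by
  have h := End.genEigenspace_inf_le_add _ _ _ _ _ _ (commute_mulDiff k A p q q r) ⟨h₁, h₂⟩
  simpa [localAt, mulDiff] using h

theorem mulSub_iterate_map (φ : A →ₗ[k] A) (G : FormalDistribution₂ A) (N : ℕ) :
    (mulSub^[N] fun m n => φ (G m n)) = fun m n => φ ((mulSub^[N] G) m n) := by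
  induction N with
  | zero => rfl
  | succ N ih =>
    rw [Function.iterate_succ_apply', Function.iterate_succ_apply', ih]
    funext m n
    simp [mulSub]

/-- The action of the difference of two variables on a distribution in three variables, regarded
as a family of distributions in these two variables. -/
theorem mulDiff_pow_apply {p q : Fin 3} (hpq : p ≠ q) (H : (Fin 3 → ℤ) → FormalDistribution₂ A)
    (hp : ∀ v, H (v + Pi.single p 1) = H v) (hq : ∀ v, H (v + Pi.single q 1) = H v)
    (N : ℕ) (v : Fin 3 → ℤ) :
    (mulDiff k A p q ^ N) (fun v => H v (v p) (v q)) v = (mulSub^[N] (H v)) (v p) (v q) := by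
  induction N generalizing v with
  | zero => simp
  | succ N ih =>
    have h : ∀ F : (Fin 3 → ℤ) → A,
        mulDiff k A p q F v = F (v + Pi.single p 1) - F (v + Pi.single q 1) := fun _ => rfl
    rw [pow_succ', Function.iterate_succ_apply', End.mul_apply, h, ih, ih, hp, hq]
    simp [mulSub, hpq, hpq.symm]

/-- The outer factor depends on the third variable only and acts linearly, so it commutes with
multiplication by the difference of the other two. -/
theorem mem_localAt_of_mulSub {p q r : Fin 3} (hpq : p ≠ q) (hrp : r ≠ p) (hrq : r ≠ q)
    (φ : ℤ → A →ₗ[k] A) {G : FormalDistribution₂ A} {N : ℕ} (hG : mulSub^[N] G = 0) :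
    (fun v => φ (v r) (G (v p) (v q))) ∈ localAt k A p q := by
  refine mem_localAt.2 ⟨N, funext fun v => ?_⟩
  rw [mulDiff_pow_apply hpq (fun v m n => φ (v r) (G m n)) (by simp [hrp]) (by simp [hrq]),
    mulSub_iterate_map, hG]
  simp

/-- Multiplications by `z₀ - z₁` and `z₁ - z₂` commute, so the power of `z₁ - z₂` that kills the
product also kills its multiple by `(z₀ - z₁)^n`, coefficient by coefficient in `z₀`. -/
theorem exists_mulSub_eq_zero (φ : ℤ → A →ₗ[k] A) {G : FormalDistribution₂ A}
    (h : (fun v => φ (v 2) (G (v 0) (v 1))) ∈ localAt k A 1 2) (n : ℕ) :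
    ∃ N, (mulSub^[N] fun l m => φ m ((mulSub^[n] G) 0 l)) = 0 := by
  obtain ⟨N, hN⟩ := mem_localAt.1 h
  refine ⟨N, funext fun l => funext fun m => ?_⟩
  -- Index `0` in the first variable selects the coefficient of `z₀⁻¹`, that is, the residue.
  have key := congrFun (congrArg (mulDiff k A 0 1 ^ n) hN) ![0, l, m]
  rw [← End.mul_apply, (((commute_mulDiff k A 0 1 1 2).pow_pow n N).eq), End.mul_apply] at key
  have hn : (mulDiff k A 0 1 ^ n) (fun v => φ (v 2) (G (v 0) (v 1))) =
      fun v => φ (v 2) ((mulSub^[n] G) (v 0) (v 1)) := funext fun v => by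
    rw [mulDiff_pow_apply (by decide) (fun v m n => φ (v 2) (G m n)) (by simp) (by simp),
      mulSub_iterate_map]
  rw [hn, mulDiff_pow_apply (by decide) (fun v l m => φ m ((mulSub^[n] G) (v 0) l))
    (by simp) (by simp)] at key
  simpa using key

theorem MutuallyLocal.symm {ι : Type w} {μ : ι → A →ₗ[k] A →ₗ[k] A} {a b : FormalDistribution A}
    (h : MutuallyLocal μ a b) : MutuallyLocal μ b a := by
  obtain ⟨N, hN⟩ := h
  refine ⟨N, fun i => ⟨?_, ?_⟩⟩ <;> funext m n
  · have := mulSub_iterate_swap (fun m n => (μ i).flip (a m) (b n)) N m n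
    rw [show (mulSub^[N] fun m n => (μ i).flip (a m) (b n)) = 0 from (hN i).2] at this
    simpa [localProd] using this
  · have := mulSub_iterate_swap (fun m n => μ i (a m) (b n)) N m n
    rw [show (mulSub^[N] fun m n => μ i (a m) (b n)) = 0 from (hN i).1] at this
    simpa [localProd] using this

end FormalDistribution

-- Reduction of the Dong property to products of degree three

namespace FormalDistribution

variable {k : Type u} [Field k] {A : Type v} [AddCommGroup A] [Module k A]

theorem mutuallyLocal_of_forall {ι : Type w} [Finite ι] {μ : ι → A →ₗ[k] A →ₗ[k] A}
    {a b : FormalDistribution A}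
    (h : ∀ i, (∃ N, localProd (μ i) N a b = 0) ∧ ∃ N, localProd (μ i).flip N a b = 0) :
    MutuallyLocal μ a b := by
  have := Fintype.ofFinite ι
  choose h₁ h₂ using h
  choose M hM using h₁
  choose N hN using h₂
  -- As there are finitely many operations, the sum bounds all exponents at once.
  refine ⟨∑ i, (M i + N i), fun i => ?_⟩
  have hi : M i + N i ≤ ∑ i, (M i + N i) :=
    Finset.single_le_sum (f := fun i => M i + N i) (fun _ _ => Nat.zero_le _) (Finset.mem_univ i)
  exact ⟨mulSub_iterate_eq_zero_of_le (hM i) (by lia),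
    mulSub_iterate_eq_zero_of_le (hN i) (by lia)⟩

/-- The distribution `(a_p i a_q) j a_r` in three variables. -/
def leftProd {ι : Type w} (μ : ι → A →ₗ[k] A →ₗ[k] A) (a : Fin 3 → FormalDistribution A)
    (i j : ι) (p q r : Fin 3) : (Fin 3 → ℤ) → A :=
  fun v => μ j (μ i (a p (v p)) (a q (v q))) (a r (v r))

/-- The distribution `a_p i (a_q j a_r)` in three variables. -/
def rightProd {ι : Type w} (μ : ι → A →ₗ[k] A →ₗ[k] A) (a : Fin 3 → FormalDistribution A)
    (i j : ι) (p q r : Fin 3) : (Fin 3 → ℤ) → A :=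
  fun v => μ i (a p (v p)) (μ j (a q (v q)) (a r (v r)))

/-- An operad has the Dong property if all products of degree three of pairwise mutually local
distributions are local in each pair of variables. -/
theorem _root_.BinaryQuadraticOperad.hasDongProperty_of_localAt {ι : Type w} [Finite ι]
    {P : BinaryQuadraticOperad k ι}
    (h : ∀ (A : Type v) [AddCommGroup A] [Module k A] (μ : ι → A →ₗ[k] A →ₗ[k] A),
      P.IsAlgebra μ → ∀ a : Fin 3 → FormalDistribution A,
        (∀ p q, p ≠ q → MutuallyLocal μ (a p) (a q)) →
        ∀ i j p q r, p ≠ q → p ≠ r → q ≠ r →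
          leftProd μ a i j p q r ∈ localAt k A 1 2 ∧ rightProd μ a i j p q r ∈ localAt k A 1 2) :
    BinaryQuadraticOperad.HasDongProperty.{u, v} P := by
  intro A _ _ μ hμ a b c hab hbc hac i n
  have hloc : ∀ p q : Fin 3, p ≠ q → MutuallyLocal μ (![a, b, c] p) (![a, b, c] q) := by
    intro p q hpq
    match p, q with
    | 0, 0 | 1, 1 | 2, 2 => exact absurd rfl hpq
    | 0, 1 => exact hab
    | 1, 0 => exact hab.symm
    | 0, 2 => exact hac
    | 2, 0 => exact hac.symm
    | 1, 2 => exact hbc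
    | 2, 1 => exact hbc.symm
  replace h := h A μ hμ ![a, b, c] hloc
  refine ⟨mutuallyLocal_of_forall fun j => ⟨?_, ?_⟩, mutuallyLocal_of_forall fun j => ⟨?_, ?_⟩⟩
  · exact exists_mulSub_eq_zero (fun m => (μ j).flip (c m))
      (h i j 0 1 2 (by decide) (by decide) (by decide)).1 n
  · exact exists_mulSub_eq_zero (fun m => μ j (c m))
      (h j i 2 0 1 (by decide) (by decide) (by decide)).2 n
  -- For the opposite operation `b` stands before `a` in the monomial, while the residue is still
  -- taken in the variable of `a`.
  · exact exists_mulSub_eq_zero (fun m => (μ j).flip (c m))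
      (G := fun l m => (μ i).flip (a l) (b m))
      (h i j 1 0 2 (by decide) (by decide) (by decide)).1 n
  · exact exists_mulSub_eq_zero (fun m => μ j (c m))
      (G := fun l m => (μ i).flip (a l) (b m))
      (h j i 2 1 0 (by decide) (by decide) (by decide)).2 n

section

variable {ι : Type w} {μ : ι → A →ₗ[k] A →ₗ[k] A} {a : Fin 3 → FormalDistribution A}
  {p q r : Fin 3}

theorem leftProd_mem_localAt (h : MutuallyLocal μ (a p) (a q)) (i j : ι) (hpq : p ≠ q)
    (hpr : p ≠ r) (hqr : q ≠ r) : leftProd μ a i j p q r ∈ localAt k A p q :=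
  mem_localAt_of_mulSub hpq hpr.symm hqr.symm (fun m => (μ j).flip (a r m)) (h.choose_spec i).1

theorem rightProd_mem_localAt (h : MutuallyLocal μ (a q) (a r)) (i j : ι) (hpq : p ≠ q)
    (hpr : p ≠ r) (hqr : q ≠ r) : rightProd μ a i j p q r ∈ localAt k A q r :=
  mem_localAt_of_mulSub hqr hpq hpr (fun m => μ i (a p m)) (h.choose_spec j).1

end

end FormalDistribution

-- Locality of all monomials of degree three

namespace DerNov

open FormalDistribution Op

variable {k : Type u} [Field k] {A : Type v} [AddCommGroup A] [Module k A]

/-- Locality at two of the three pairs of variables implies locality at each pair. -/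
theorem forall_mem_localAt {F : (Fin 3 → ℤ) → A} {p q r : Fin 3} (hpq : p ≠ q) (hpr : p ≠ r)
    (hqr : q ≠ r) (h₁ : F ∈ localAt k A p q) (h₂ : F ∈ localAt k A p r) (s t : Fin 3)
    (hst : s ≠ t) : F ∈ localAt k A s t := by
  have h₃ : F ∈ localAt k A q r := mem_localAt_of_mem_of_mem (mem_localAt_symm h₁) h₂
  have h : ∀ s : Fin 3, s = p ∨ s = q ∨ s = r := by
    clear h₁ h₂ h₃
    revert p q r; decide
  rcases h s with rfl | rfl | rfl <;> rcases h t with rfl | rfl | rfl <;>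
    first | exact absurd rfl hst | assumption | (apply mem_localAt_symm; assumption)

theorem prod_mem_localAt {μ : Op → A →ₗ[k] A →ₗ[k] A} (hμ : (derNov k).dual.IsAlgebra μ)
    {a : Fin 3 → FormalDistribution A} (ha : ∀ p q, p ≠ q → MutuallyLocal μ (a p) (a q))
    (i j : Op) {p q r : Fin 3} (hpq : p ≠ q) (hpr : p ≠ r) (hqr : q ≠ r) {s t : Fin 3}
    (hst : s ≠ t) :
    leftProd μ a i j p q r ∈ localAt k A s t ∧ rightProd μ a i j p q r ∈ localAt k A s t := by
  have hl : ∀ i j {p q r : Fin 3}, p ≠ q → p ≠ r → q ≠ r →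
      leftProd μ a i j p q r ∈ localAt k A p q := fun i j _ _ _ h₁ h₂ h₃ =>
    leftProd_mem_localAt (ha _ _ h₁) i j h₁ h₂ h₃
  have hr : ∀ i j {p q r : Fin 3}, p ≠ q → p ≠ r → q ≠ r →
      rightProd μ a i j p q r ∈ localAt k A q r := fun i j _ _ _ h₁ h₂ h₃ =>
    rightProd_mem_localAt (ha _ _ h₃) i j h₁ h₂ h₃
  -- For the three symmetric types, the symmetry makes a second pair inner.
  have lss : ∀ {p q r : Fin 3}, p ≠ q → p ≠ r → q ≠ r → ∀ s t, s ≠ t →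
      leftProd μ a succ succ p q r ∈ localAt k A s t := by
    intro p q r h₁ h₂ h₃
    have e : leftProd μ a succ succ p q r = leftProd μ a succ succ p r q :=
      funext fun v => succ_succ_right_comm hμ _ _ _
    exact forall_mem_localAt h₁ h₂ h₃ (hl _ _ h₁ h₂ h₃) (e ▸ hl _ _ h₂ h₁ h₃.symm)
  have lps : ∀ {p q r : Fin 3}, p ≠ q → p ≠ r → q ≠ r → ∀ s t, s ≠ t →
      leftProd μ a prec succ p q r ∈ localAt k A s t := by
    intro p q r h₁ h₂ h₃
    have e : leftProd μ a prec succ p q r = leftProd μ a prec succ r q p :=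
      funext fun v => prec_succ_swap hμ _ _ _
    refine forall_mem_localAt h₁.symm h₃ h₂ ?_ ?_
    · exact mem_localAt_symm (hl _ _ h₁ h₂ h₃)
    · exact e ▸ mem_localAt_symm (hl _ _ h₃.symm h₂.symm h₁.symm)
  have rss : ∀ {p q r : Fin 3}, p ≠ q → p ≠ r → q ≠ r → ∀ s t, s ≠ t →
      rightProd μ a succ succ p q r ∈ localAt k A s t := by
    intro p q r h₁ h₂ h₃
    have e : rightProd μ a succ succ p q r = rightProd μ a succ succ q p r :=
      funext fun v => succ_succ_left_comm hμ _ _ _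
    refine forall_mem_localAt h₂.symm h₃.symm h₁ ?_ ?_
    · exact e ▸ mem_localAt_symm (hr _ _ h₁.symm h₃ h₂)
    · exact mem_localAt_symm (hr _ _ h₁ h₂ h₃)
  -- These four types reduce to the symmetric ones.
  have lsp : leftProd μ a succ prec p q r =
      leftProd μ a succ succ p q r - rightProd μ a succ succ p r q :=
    funext fun v => sub_eq_zero.1 (succ_prec_eq hμ _ _ _)
  have rsp : rightProd μ a succ prec p q r = - leftProd μ a prec succ p r q :=
    funext fun v => eq_neg_of_add_eq_zero_left (succ_prec_right_eq hμ _ _ _)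
  have rpp : rightProd μ a prec prec p q r = - leftProd μ a prec succ p r q :=
    funext fun v => eq_neg_of_add_eq_zero_left (prec_prec_right_eq hμ _ _ _)
  have rps : rightProd μ a prec succ p q r = 0 :=
    funext fun v => prec_succ_right_eq_zero hμ _ _ _
  -- This one is only symmetric up to terms already local in every pair; the swapped monomial has
  -- the inner pair `p`, `r`, which is the second pair required.
  have lpp : leftProd μ a prec prec p q r = leftProd μ a prec prec p r q +
      leftProd μ a prec succ p q r - leftProd μ a prec succ p r q :=
    funext fun v => eq_sub_of_add_eq (prec_prec_add_symm hμ _ _ _)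
  have lps₁ := lps hpq hpr hqr
  have lps₂ := lps hpr hpq hqr.symm
  rcases i with _ | _ <;> rcases j with _ | _
  · refine ⟨?_, rpp ▸ neg_mem (lps₂ s t hst)⟩
    refine forall_mem_localAt hpq hpr hqr (hl _ _ hpq hpr hqr) ?_ s t hst
    rw [lpp]
    exact sub_mem (add_mem (hl _ _ hpr hpq hqr.symm) (lps₁ p r hpr)) (lps₂ p r hpr)
  · exact ⟨lps₁ s t hst, rps ▸ zero_mem _⟩
  · exact ⟨lsp ▸ sub_mem (lss hpq hpr hqr s t hst) (rss hpr hpq hqr.symm s t hst),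
      rsp ▸ neg_mem (lps₂ s t hst)⟩
  · exact ⟨lss hpq hpr hqr s t hst, rss hpq hpr hqr s t hst⟩

end DerNov

theorem mainTheorem8 (k : Type u) [Field k] [CharZero k] :
    BinaryQuadraticOperad.HasDongProperty.{u, v} (derNov k).dual :=
  BinaryQuadraticOperad.hasDongProperty_of_localAt fun _ _ _ _ hμ _ ha i j _ _ _ hpq hpr hqr =>
    DerNov.prod_mem_localAt hμ ha i j hpq hpr hqr (by decide)
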